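/- Let $k$ be a field and let $X$ be a noetherian scheme over $k$. Let $D^b(X)$ be the bounded derived category of the abelian category of coherent sheaves on $X$; a coherent sheaf is regarded as an object of $D^b(X)$ placed in degree $0$. A family of objects \emph{generates} $D^b(X)$ if the smallest thick triangulated subcategory containing it is all of $D^b(X)$. Let $(\mathcal F_0,\dots,\mathcal F_n)$ be a full strong exceptional collection of coherent sheaves on $X$, that is: \begin{itemize} \item $\operatorname{Hom}(\mathcal F_i,\mathcal F_i)=k$ and $\operatorname{Hom}(\mathcal F_i,\mathcal F_i[m])=0$ for all $i$ and all $m\neq 0$; \item $\operatorname{Hom}(\mathcal F_j,\mathcal F_i[m])=0$ for all $m\in\mathbb Z$ and $0\le i<j\le n$; \item $\operatorname{Hom}(\mathcal F_j,\mathcal F_i[m])=0$ for all $m\neq 0$ and $0\le j\le i\le n$; \item $\mathcal F_0,\dots,\mathcal F_n$ generate $D^b(X)$. \end{itemize} Then for all integers $l_0,\dots,l_n\ge 1$ the coherent sheaf $\mathcal T=\bigoplus_{i=0}^n\mathcal F_i^{\oplus l_i}$ is a tilting sheaf on $X$, that is: \begin{enumerate} \item the ring $\operatorname{End}(\mathcal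 T)$ has finite global dimension: there is an integer $d$ such that every left $\operatorname{End}(\mathcal T)$-module has projective dimension at most $d$; \item $\operatorname{Ext}^i(\mathcal T,\mathcal T)=0$ for all $i>0$, the groups $\operatorname{Ext}$ being formed in the category of coherent sheaves on $X$; \item $\mathcal T$ generates $D^b(X)$. \end{enumerate} -/

import Mathlib

universe u

open CategoryTheory CategoryTheory.Limits AlgebraicGeometry Opposite TopologicalSpace

namespace CohSheaf

section Spec
variable {R : CommRingCat.{u}} 

theorem map_eq_zero {M : (Spec R).Modules} (hM : M.IsQuasicoherent) (r : R) {D : (Spec R).Opens}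
    (hD : D = PrimeSpectrum.basicOpen r) (t : Γ(M, ⊤)) (ht : M.presheaf.map D.leTop.op t = 0) :
    ∃ n : ℕ, r ^ n • t = 0 := by
  subst hD
  have h := (isIso_fromTildeΓ_iff_isLocalizing M).1 inferInstance
  have hr : IsLocalizedModule.Away r _ := h r
  obtain ⟨⟨_, m, rfl⟩, hm⟩ := (IsLocalizedModule.eq_zero_iff (.powers r)
    ((modulesSpecToSheaf.obj M).obj.map (PrimeSpectrum.basicOpen r).leTop.op).hom).mp ht
  exact ⟨m, hm⟩

theorem exists_map_eq {M : (Spec R).Modules} (hM : M.IsQuasicoherent) (r : R) {D : (Spec R).Opens}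
    (hD : D = PrimeSpectrum.basicOpen r) (s : Γ(M, D)) :
    ∃ (n : ℕ) (t : Γ(M, ⊤)), M.presheaf.map D.leTop.op t = r ^ n • s := by
  subst hD
  have h := (isIso_fromTildeΓ_iff_isLocalizing M).1 inferInstance
  have hr : IsLocalizedModule.Away r _ := h r
  obtain ⟨n, y, hy⟩ := hr.surj _ _ s
  exact ⟨n, y, hy.symm⟩

theorem isQuasicoherent_kernel {K M N : (Spec R).Modules} (i : K ⟶ M) (f : M ⟶ N)
    (hM : M.IsQuasicoherent) (hN : N.IsQuasicoherent)
    (hi : ∀ U, Function.Injective (i.app U))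
    (hker : ∀ U x, f.app U x = 0 ↔ ∃ y, i.app U y = x) : K.IsQuasicoherent := by
  rw [isQuasicoherent_iff_isIso_fromTildeΓ, isIso_fromTildeΓ_iff_isLocalizing]
  have smul_app : ∀ {A B : (Spec R).Modules} (g : A ⟶ B) (U : (Spec R).Opens) (r : R)
      (x : Γ(A, U)), g.app U (r • x) = r • g.app U x := fun g U r x =>
    g.app_smul _ x
  have nat : ∀ {A B : (Spec R).Modules} (g : A ⟶ B) (D : (Spec R).Opens) (x : Γ(A, ⊤)),
      g.app D (A.presheaf.map D.leTop.op x) =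
        B.presheaf.map D.leTop.op (g.app ⊤ x) := fun g D x =>
    congr($(g.mapPresheaf.naturality D.leTop.op) x)
  intro r
  obtain ⟨D, hD⟩ : ∃ D : (Spec R).Opens, D = PrimeSpectrum.basicOpen r := ⟨_, rfl⟩
  rw [← hD]
  refine IsLocalizedModule.Away.mk_of_addCommGroup ?_ ?_ ?_
  · exact Scheme.Modules.isUnit_algebraMap_end_of_le_basicOpen r hD.le
  · intro (x : Γ(K, D))
    obtain ⟨n, t, ht⟩ := exists_map_eq hM r hD (i.app _ x)
    have h0 : N.presheaf.map D.leTop.op (f.app ⊤ t) = 0 := by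
      rw [← nat, ht, smul_app, (hker _ _).2 ⟨x, rfl⟩, smul_zero]
    obtain ⟨m, hm⟩ := map_eq_zero hN r hD _ h0
    rw [← smul_app, hker] at hm
    obtain ⟨y, hy⟩ := hm
    have key : r ^ (m + n) • x = K.presheaf.map D.leTop.op y := by
      apply hi
      rw [nat, hy, smul_app, pow_add, mul_smul, ← ht]
      exact (M.map_smul_Spec _ _ _).symm
    exact ⟨m + n, y, key⟩
  · intro (y : Γ(K, ⊤)) (hy : K.presheaf.map D.leTop.op y = 0)
    have h0 : M.presheaf.map D.leTop.op (i.app ⊤ y) = 0 := by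
      rw [← nat, hy, map_zero]
    obtain ⟨m, hm⟩ := map_eq_zero hM r hD _ h0
    refine ⟨m, hi _ ?_⟩
    change i.app _ (r ^ m • y) = i.app _ 0
    rw [smul_app, hm, map_zero]

theorem epi_map_of_counit {C D : Type*} [Category* C] [Category* D] {F : C ⥤ D} {G : D ⥤ C}
    (adj : F ⊣ G) [F.Faithful] {M N : D} (p : M ⟶ N) [IsIso (adj.counit.app M)]
    [IsIso (adj.counit.app N)] [Epi p] : Epi (G.map p) := by
  have h : F.map (G.map p) = adj.counit.app M ≫ p ≫ inv (adj.counit.app N) := by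
    rw [← Category.assoc]
    exact (IsIso.eq_comp_inv _).2 (adj.counit_naturality p)
  have h1 : Epi (F.map (G.map p)) := by rw [h]; infer_instance
  exact F.epi_of_epi_map h1

theorem surjective_of_epi {M N : (Spec R).Modules} (p : M ⟶ N)
    (hM : M.IsQuasicoherent) (hN : N.IsQuasicoherent)
    [Epi p] : Function.Surjective (p.app ⊤) := by
  have hM' : IsIso ((tilde.adjunction (R := R)).counit.app M) :=
    Scheme.Modules.isIso_fromTildeΓ_of_isQuasicoherent M
  have hN' : IsIso ((tilde.adjunction (R := R)).counit.app N) :=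
    Scheme.Modules.isIso_fromTildeΓ_of_isQuasicoherent N
  exact (ModuleCat.epi_iff_surjective (moduleSpecΓFunctor.map p)).1
    (epi_map_of_counit tilde.adjunction p)

theorem isQuasicoherent_cokernel {M N C : (Spec R).Modules} (f : M ⟶ N) (p : N ⟶ C) (w : f ≫ p = 0)
    (hc : IsColimit (CokernelCofork.ofπ p w)) (hM : M.IsQuasicoherent) (hN : N.IsQuasicoherent) :
    C.IsQuasicoherent := by
  have : (tilde.functor R).essImage C := by
    have h := (tilde.functor R).essImage.prop_of_isColimit (J := WalkingParallelPair) hc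
    refine h ?_
    rw [essImage_tilde]
    rintro (_ | _)
    · exact hM
    · exact hN
  rw [essImage_tilde] at this
  exact this

end Spec

section
variable {X : Scheme.{u}}


/-- A presentation transported along an isomorphism. -/
noncomputable def presentationOfIso {M N : X.Modules} (e : M ≅ N) (P : M.Presentation) :
    N.Presentation :=
  haveI : @IsIso (SheafOfModules.{u} X.ringCatSheaf) _ M N e.hom := (inferInstance : IsIso e.hom)
  SheafOfModules.Presentation.ofIsIso.{u, u, u} e.hom P

theorem nonempty_presentation {R : CommRingCat.{u}} {M : (Spec R).Modules}
    (hM : M.IsQuasicoherent) : Nonempty M.Presentation := by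
  have h : (tilde.functor R).essImage M := by rw [essImage_tilde]; exact hM
  obtain ⟨N, ⟨e⟩⟩ := h
  exact ⟨presentationOfIso e
    (presentationTilde N .univ (by simp) _ (Submodule.span_eq _))⟩

theorem isQuasicoherent_of_affine (M : X.Modules)
    (h : ∀ (U : X.Opens) (hU : IsAffineOpen U), (M.restrict hU.fromSpec).IsQuasicoherent) :
    M.IsQuasicoherent := by
  suffices D : SheafOfModules.QuasicoherentData.{u, u, u, u} M from D.isQuasicoherent
  refine { I := X.affineOpens, X := fun U => U.1, coversTop := ?_, presentation := ?_ }
  · rw [Opens.coversTop_iff]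
    exact iSup_affineOpens_eq_top X
  · rintro ⟨U, hU⟩
    replace hU : IsAffineOpen U := hU
    let P := (nonempty_presentation (h U hU)).some
    let P1 := Scheme.Modules.presentationRestrict hU.isoSpec.hom P
    let e : (M.restrict hU.fromSpec).restrict hU.isoSpec.hom ≅ M.restrict U.ι :=
      ((Scheme.Modules.restrictFunctorComp _ _).app M).symm ≪≫
        (Scheme.Modules.restrictFunctorCongr hU.isoSpec_hom_fromSpec).app M
    let P2 := presentationOfIso e P1
    let E : SheafOfModules.{u} (X.ringCatSheaf.over U) ≌
      SheafOfModules.{u} (U : Scheme.{u}).ringCatSheaf := Scheme.Modules.overEquiv U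
    have : PreservesColimitsOfSize.{u, u} E.inverse := inferInstance
    let η0 : E.functor.obj (SheafOfModules.unit (X.ringCatSheaf.over U)) ≅
        SheafOfModules.unit (U : Scheme.{u}).ringCatSheaf :=
      ((Scheme.Modules.overFunctorEquiv U).app (SheafOfModules.unit X.ringCatSheaf)) ≪≫
        Scheme.Modules.restrictUnitIso U.ι
    let η := E.unitIso.app _ ≪≫ E.inverse.mapIso η0
    let P3 := SheafOfModules.Presentation.map.{u, u, u} P2 E.inverse η
    let e3 : E.inverse.obj (M.restrict U.ι) ≅ M.over U :=
      E.inverse.mapIso ((Scheme.Modules.overFunctorEquiv U).app M).symm ≪≫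
        (E.unitIso.app _).symm
    exact SheafOfModules.Presentation.ofIsIso e3.hom P3

instance restrict_biprod {Y : Scheme.{u}} (j : Y ⟶ X) [IsOpenImmersion j] :
    PreservesBinaryBiproducts (Scheme.Modules.restrictFunctor j) :=
  preservesBinaryBiproducts_of_preservesBinaryCoproducts _

instance restrict_additive {Y : Scheme.{u}} (j : Y ⟶ X) [IsOpenImmersion j] :
    (Scheme.Modules.restrictFunctor j).Additive :=
  Functor.additive_of_preservesBinaryBiproducts _

instance (U : X.Opens) : Functor.Additive (Scheme.Modules.toPresheaf X ⋙ (evaluation _ _).obj (op U)) where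
  map_add := rfl

theorem isKernel_app {M N : X.Modules} (f : M ⟶ N) (k : KernelFork f) (hk : IsLimit k)
    (U : X.Opens) : Function.Injective (Scheme.Modules.Hom.app k.ι U) ∧
    ∀ x, f.app U x = 0 ↔ ∃ y, Scheme.Modules.Hom.app k.ι U y = x := by
  let G := Scheme.Modules.toPresheaf X ⋙ (evaluation _ _).obj (op U)
  have : PreservesFiniteLimits (Scheme.Modules.toPresheaf X) :=
    PreservesLimitsOfSize.preservesFiniteLimits _
  have : PreservesFiniteLimits ((evaluation (Opens X)ᵒᵖ Ab.{u}).obj (op U)) :=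
    ⟨fun J _ _ => inferInstance⟩
  have : PreservesFiniteLimits G := comp_preservesFiniteLimits _ _
  have hG := KernelFork.mapIsLimit k hk G
  have hm : Mono (G.map k.ι) := by
    have : Mono k.ι := Fork.IsLimit.mono hk
    infer_instance
  refine ⟨(AddCommGrpCat.mono_iff_injective _).1 hm, fun x => ⟨fun hx => ?_, ?_⟩⟩
  · let S := ShortComplex.mk (G.map k.ι) (G.map f) (by rw [← G.map_comp, k.condition, G.map_zero])
    have hS : S.Exact := S.exact_of_f_is_kernel hG
    exact (ShortComplex.ab_exact_iff S).1 hS x hx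
  · rintro ⟨y, rfl⟩
    have := k.condition
    exact congr($(this).app U y)


variable (X) in
/-- An `𝒪_X`-module is coherent if it is quasi-coherent and its sections over every affine
open `U` form a finitely generated `Γ(X, U)`-module. This is the usual notion when `X` is locally
noetherian. -/
def isCoherent : ObjectProperty X.Modules := fun M =>
  M.IsQuasicoherent ∧ ∀ U : X.Opens, IsAffineOpen U → Module.Finite Γ(X, U) Γ(M, U)

/-- The action of a morphism on sections, as a linear map. -/
noncomputable def appₗ {M N : X.Modules} (f : M ⟶ N) (U : X.Opens) :
    Γ(M, U) →ₗ[Γ(X, U)] Γ(N, U) where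
  toFun := f.app U
  map_add' := map_add _
  map_smul' r x := f.app_smul r x

instance [IsLocallyNoetherian X] : (isCoherent X).IsClosedUnderKernels where
  kernels_le := by
    rintro _ ⟨f, k, hk, hM, hN⟩
    have H := isKernel_app f k hk
    refine ⟨isQuasicoherent_of_affine _ fun U hU => ?_, fun U hU => ?_⟩
    · have hM' := hM.1
      have hN' := hN.1
      exact isQuasicoherent_kernel ((Scheme.Modules.restrictFunctor hU.fromSpec).map k.ι)
        ((Scheme.Modules.restrictFunctor hU.fromSpec).map f)
        (Scheme.Modules.isQuasicoherent_restrictFunctor _ _)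
        (Scheme.Modules.isQuasicoherent_restrictFunctor _ _)
        (fun V => (H (hU.fromSpec ''ᵁ V)).1) (fun V => (H (hU.fromSpec ''ᵁ V)).2)
    · have := IsLocallyNoetherian.component_noetherian ⟨U, hU⟩
      have := hM.2 U hU
      exact Module.Finite.of_injective (appₗ k.ι U) (H U).1

instance : (isCoherent X).IsClosedUnderCokernels where
  cokernels_le := by
    rintro _ ⟨f, k, hk, hM, hN⟩
    have hM' := hM.1
    have hN' := hN.1
    have hQ : ∀ (U : X.Opens) (hU : IsAffineOpen U),
        (Scheme.Modules.restrict k.pt hU.fromSpec).IsQuasicoherent := fun U hU =>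
      isQuasicoherent_cokernel _ _ (by rw [← Functor.map_comp, k.condition, Functor.map_zero])
        (CokernelCofork.mapIsColimit k hk (Scheme.Modules.restrictFunctor hU.fromSpec))
        (Scheme.Modules.isQuasicoherent_restrictFunctor _ _)
        (Scheme.Modules.isQuasicoherent_restrictFunctor _ _)
    refine ⟨isQuasicoherent_of_affine _ hQ, fun U hU => ?_⟩
    have : Epi k.π := Cofork.IsColimit.epi hk
    have hs : Function.Surjective (k.π.app (hU.fromSpec ''ᵁ ⊤)) :=
      surjective_of_epi ((Scheme.Modules.restrictFunctor hU.fromSpec).map k.π)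
        (Scheme.Modules.isQuasicoherent_restrictFunctor _ _) (hQ U hU)
    rw [Scheme.Hom.image_top_eq_opensRange, hU.opensRange_fromSpec] at hs
    have := hN.2 U hU
    exact Module.Finite.of_surjective (appₗ k.π U) hs

open ZeroObject in
theorem isQuasicoherent_of_isZero {R : CommRingCat.{u}} {M : (Spec R).Modules} (hM : IsZero M) :
    M.IsQuasicoherent := by
  have h : (tilde.functor R).essImage M :=
    ⟨0, ⟨((tilde.functor R).map_isZero (isZero_zero _)).iso hM⟩⟩
  rw [essImage_tilde] at h
  exact h

theorem isQuasicoherent_biprod {R : CommRingCat.{u}} {M N : (Spec R).Modules}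
    (hM : M.IsQuasicoherent) (hN : N.IsQuasicoherent) : (M ⊞ N).IsQuasicoherent := by
  have h : (tilde.functor R).essImage (M ⊞ N) := by
    have hM' : (tilde.functor R).essImage M := by rw [essImage_tilde]; exact hM
    have hN' : (tilde.functor R).essImage N := by rw [essImage_tilde]; exact hN
    obtain ⟨A, ⟨a⟩⟩ := hM'
    obtain ⟨B, ⟨b⟩⟩ := hN'
    have : PreservesBinaryBiproducts (tilde.functor R) :=
      preservesBinaryBiproducts_of_preservesBinaryCoproducts _
    exact ⟨A ⊞ B, ⟨(tilde.functor R).mapBiprod A B ≪≫ biprod.mapIso a b⟩⟩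
  rw [essImage_tilde] at h
  exact h

theorem isQuasicoherent_of_iso {M N : X.Modules} (e : M ≅ N) (hM : M.IsQuasicoherent) :
    N.IsQuasicoherent :=
  (SheafOfModules.isQuasicoherent X.ringCatSheaf).prop_of_iso e hM

open ZeroObject in
instance : (isCoherent X).ContainsZero where
  exists_zero := by
    refine ⟨0, isZero_zero _, isQuasicoherent_of_affine _ fun U hU => ?_, fun U hU => ?_⟩
    · exact isQuasicoherent_of_isZero
        ((Scheme.Modules.restrictFunctor hU.fromSpec).map_isZero (isZero_zero _))
    · have h : ∀ x : Γ((0 : X.Modules), U), x = 0 := fun x => by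
        have h1 : (𝟙 (0 : X.Modules)) = 0 := (isZero_zero _).eq_of_src _ _
        exact congr($(h1).app U x)
      exact ⟨⟨∅, eq_top_iff.2 fun x _ => by rw [h x]; exact zero_mem _⟩⟩

instance : (isCoherent X).IsClosedUnderIsomorphisms where
  of_iso {M N} e hM := by
    have hM' := hM.1
    refine ⟨isQuasicoherent_of_iso e hM', fun U hU => ?_⟩
    have := hM.2 U hU
    refine Module.Finite.of_surjective (appₗ e.hom U) fun y => ⟨e.inv.app U y, ?_⟩
    exact congr($(e.inv_hom_id).app U y)

theorem isCoherent_biprod [IsLocallyNoetherian X] {M N : X.Modules} (hM : isCoherent X M)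
    (hN : isCoherent X N) : isCoherent X (M ⊞ N) := by
  have hM' := hM.1
  have hN' := hN.1
  refine ⟨isQuasicoherent_of_affine _ fun U hU => ?_, fun U hU => ?_⟩
  · let F := Scheme.Modules.restrictFunctor hU.fromSpec
    let e : F.obj M ⊞ F.obj N ≅ F.obj (M ⊞ N) := (F.mapBiprod M N).symm
    exact isQuasicoherent_of_iso e
      (isQuasicoherent_biprod (Scheme.Modules.isQuasicoherent_restrictFunctor _ _)
        (Scheme.Modules.isQuasicoherent_restrictFunctor _ _))
  · have := IsLocallyNoetherian.component_noetherian ⟨U, hU⟩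
    have := hM.2 U hU
    have := hN.2 U hU
    refine Module.Finite.of_injective
      ((appₗ (biprod.fst : M ⊞ N ⟶ M) U).prod (appₗ (biprod.snd : M ⊞ N ⟶ N) U)) ?_
    rw [injective_iff_map_eq_zero]
    intro x hx
    have h1 : (biprod.fst : M ⊞ N ⟶ M).app U x = 0 := congr_arg Prod.fst hx
    have h2 : (biprod.snd : M ⊞ N ⟶ N).app U x = 0 := congr_arg Prod.snd hx
    have h3 := congr($(biprod.total (X := M) (Y := N)).app U x)
    replace h3 : (biprod.inl : M ⟶ M ⊞ N).app U ((biprod.fst : M ⊞ N ⟶ M).app U x) +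
      (biprod.inr : N ⟶ M ⊞ N).app U ((biprod.snd : M ⊞ N ⟶ N).app U x) = x := h3
    rw [← h3, h1, h2, map_zero, map_zero, add_zero]

instance [IsLocallyNoetherian X] : (isCoherent X).IsClosedUnderBinaryProducts where
  limitsOfShape_le := by
    rintro P ⟨p⟩
    let e : P ≅ p.diag.obj ⟨.left⟩ ⊞ p.diag.obj ⟨.right⟩ :=
      p.isLimit.conePointsIsoOfNatIso (BinaryBiproduct.isLimit _ _) (diagramIsoPair p.diag)
    exact (isCoherent X).prop_of_iso e.symm
      (isCoherent_biprod (p.prop_diag_obj _) (p.prop_diag_obj _))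

instance [IsLocallyNoetherian X] : (isCoherent X).IsClosedUnderFiniteProducts := 
  ObjectProperty.IsClosedUnderFiniteProducts.mk'

/-- Multiplication by a global function on an `𝒪_X`-module. -/
noncomputable def globalSmul (r : Γ(X, ⊤)) (M : X.Modules) : M ⟶ M where
  val := PresheafOfModules.homMk (M₁ := M.val) (M₂ := M.val)
    { app := fun U => M.smul (X.presheaf.map U.unop.leTop.op r)
      naturality := fun U V i => by
        have h := Scheme.Modules.map_comp_smul (M := M) i.unop
          (X.presheaf.map U.unop.leTop.op r)
        rw [← X.presheaf.map_comp_apply] at h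
        exact h.symm }
    (fun U s m => by
      let s' : Γ(X, U.unop) := s
      let m' : Γ(M, U.unop) := m
      exact smul_comm (X.presheaf.map U.unop.leTop.op r) s' m')

theorem globalSmul_app (r : Γ(X, ⊤)) (M : X.Modules) (U : X.Opens) (x : Γ(M, U)) :
    (globalSmul r M).app U x = X.presheaf.map U.leTop.op r • x := rfl

variable (X) in
/-- The ring of global functions acts on the category of `𝒪_X`-modules by multiplication. -/
noncomputable def toCenter : Γ(X, ⊤) →+* CatCenter X.Modules where
  toFun r :=
    { app := globalSmul r
      naturality := fun M N f => by
        refine Scheme.Modules.hom_ext _ _ fun U => ?_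
        ext x
        exact (f.app_smul (X.presheaf.map U.leTop.op r) x).symm }
  map_one' := by
    refine CatCenter.ext _ _ fun M => Scheme.Modules.hom_ext _ _ fun U => ?_
    ext x
    change X.presheaf.map U.leTop.op 1 • x = x
    rw [map_one, one_smul]
  map_mul' r s := by
    refine CatCenter.ext _ _ fun M => Scheme.Modules.hom_ext _ _ fun U => ?_
    ext x
    change X.presheaf.map U.leTop.op (r * s) • x =
      X.presheaf.map U.leTop.op r • X.presheaf.map U.leTop.op s • x
    rw [map_mul, mul_smul]
  map_zero' := by
    refine CatCenter.ext _ _ fun M => Scheme.Modules.hom_ext _ _ fun U => ?_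
    ext x
    change X.presheaf.map U.leTop.op 0 • x = 0
    rw [map_zero, zero_smul]
  map_add' r s := by
    refine CatCenter.ext _ _ fun M => Scheme.Modules.hom_ext _ _ fun U => ?_
    ext x
    change X.presheaf.map U.leTop.op (r + s) • x =
      X.presheaf.map U.leTop.op r • x + X.presheaf.map U.leTop.op s • x
    rw [map_add, add_smul]

/-- For a scheme `X` over a commutative ring `k`, the category of `𝒪_X`-modules is `k`-linear:
a scalar acts by multiplication by its image in `Γ(X, ⊤)`. -/
noncomputable instance (k : Type u) [CommRing k] [X.Over (Spec (.of k))] : Linear k X.Modules :=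
  Linear.ofRingMorphism ((toCenter X).comp
    ((Scheme.ΓSpecIso (.of k)).inv ≫ (X ↘ Spec (.of k)).appTop).hom)

end

/-- The category of coherent sheaves on a scheme. -/
abbrev Coh (X : Scheme.{u}) := (isCoherent X).FullSubcategory

instance (X : Scheme.{u}) [IsLocallyNoetherian X] : HasFiniteBiproducts (Coh X) :=
  Abelian.hasFiniteBiproducts

/-- The derived category of coherent sheaves is formed as the standard localization. -/
noncomputable instance (X : Scheme.{u}) [IsLocallyNoetherian X] :
    HasDerivedCategory.{u + 1} (Coh X) :=
  HasDerivedCategory.standard _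

instance (X : Scheme.{u}) [IsLocallyNoetherian X] : HasExt.{u + 1} (Coh X) :=
  HasExt.standard _

/-- The bounded derived category `D^b(X)` of coherent sheaves on `X`. -/
abbrev Db (X : Scheme.{u}) [IsLocallyNoetherian X] := DerivedCategory.Bounded (Coh X)

/-- A coherent sheaf as an object of `D^b(X)`, placed in degree `0`. -/
noncomputable abbrev toDb {X : Scheme.{u}} [IsLocallyNoetherian X] (F : Coh X) : Db X where
  obj := (DerivedCategory.singleFunctor (Coh X) 0).obj F
  property := ⟨⟨0, inferInstance⟩, ⟨0, inferInstance⟩⟩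

section Triangulated

variable (k : Type*) [Field k] {D : Type*} [Category* D] [HasZeroObject D] [HasShift D ℤ]
  [Preadditive D] [∀ n : ℤ, (shiftFunctor D n).Additive] [Pretriangulated D]

/-- An exceptional object of a `k`-linear triangulated category: `Hom(E, E) = k` and
`Hom(E, E[m]) = 0` for `m ≠ 0`. -/
structure IsExceptional [Linear k D] (E : D) : Prop where
  hom_self : Function.Bijective fun c : k => c • 𝟙 E
  hom_shift : ∀ m : ℤ, m ≠ 0 → ∀ f : E ⟶ E⟦m⟧, f = 0

/-- An exceptional collection `(E_0, …, E_n)`. -/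
structure IsExceptionalCollection [Linear k D] {n : ℕ} (E : Fin (n + 1) → D) : Prop where
  exceptional : ∀ i, IsExceptional k (E i)
  hom_shift : ∀ i j, i < j → ∀ (m : ℤ) (f : E j ⟶ (E i)⟦m⟧), f = 0

/-- A strong exceptional collection. -/
structure IsStrongExceptionalCollection [Linear k D] {n : ℕ} (E : Fin (n + 1) → D) : Prop extends
    IsExceptionalCollection k E where
  strong : ∀ i j, j ≤ i → ∀ m : ℤ, m ≠ 0 → ∀ f : E j ⟶ (E i)⟦m⟧, f = 0

/-- A family of objects generates `D` if every object lies in the smallest thick triangulated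
subcategory containing the family. -/
def Generates {ι : Type*} (E : ι → D) : Prop :=
  (ObjectProperty.ofObj E).IsClassicalTriangulatedGenerator

/-- A full strong exceptional collection. -/
structure IsFullStrongExceptionalCollection [Linear k D] {n : ℕ} (E : Fin (n + 1) → D) : Prop
    extends IsStrongExceptionalCollection k E where
  full : Generates E

end Triangulated

/-- A ring has finite global dimension if the projective dimensions of its left modules are
bounded by an integer. -/
def HasFiniteGlobalDimension (R : Type u) [Ring R] : Prop :=
  ∃ d : ℕ, ∀ M : ModuleCat.{u} R, HasProjectiveDimensionLE M d

/-- A tilting sheaf: the endomorphism ring has finite global dimension, there are no higher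
self-extensions, and the sheaf generates `D^b(X)`. -/
structure IsTilting {X : Scheme.{u}} [IsLocallyNoetherian X] (T : Coh X) : Prop where
  finite_globalDimension : HasFiniteGlobalDimension (End T)
  ext_self : ∀ i : ℕ, 0 < i → ∀ e : Abelian.Ext T T i, e = 0
  generates : Generates fun _ : Unit => toDb T

end CohSheaf

/-! ### Projective dimension over triangular rings -/

section Ring

variable {R : Type u} [Ring R]

/-! Write `T` for the sheaf. It generates because every `F i` is a direct summand of it and thick
subcategories are closed under summands (`Generates.of_retract`). Its higher Ext groups vanish
because Ext is additive in both arguments and is computed by morphisms into shifts in `D^b(X)`.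

The finite global dimension of `R = End T` needs an argument. Let `e i` be the idempotent of `R`
projecting onto one chosen copy of `F i`. Then `e i * R * e i` consists of the scalar multiples of
`e i`, and `e i * R * e j = 0` for `i < j`. All copies of `F i` are isomorphic, so the `e i`
generate the unit two-sided ideal; this replaces a Morita reduction to the case of multiplicities
one. A module is supported on the vertices `i` with `e i • M ≠ 0`. By
`exists_projective_cover_of_triangular`, passing to a suitable syzygy removes the lowest vertex of
the support, so all vertices are exhausted in finitely many steps. The vector spaces `e i • M` may
be infinite-dimensional. -/

/-- A module killed by generators of the unit two-sided ideal is zero. -/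
theorem subsingleton_of_smul_eq_zero {ι : Type*} {e : ι → R}
    (gen : (1 : R) ∈ TwoSidedIdeal.span (Set.range e)) {M : Type*} [AddCommGroup M] [Module R M]
    (h : ∀ i (m : M), e i • m = 0) : Subsingleton M := by
  have hle : TwoSidedIdeal.span (Set.range e) ≤ TwoSidedIdeal.ker (Module.toAddMonoidEnd R M) := by
    rw [TwoSidedIdeal.span_le]
    rintro _ ⟨i, rfl⟩
    rw [SetLike.mem_coe, TwoSidedIdeal.mem_ker]
    ext m
    exact h i m
  have h1 := hle gen
  rw [TwoSidedIdeal.mem_ker, map_one] at h1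
  refine subsingleton_of_forall_eq 0 fun m => ?_
  exact DFunLike.congr_fun h1 m

/-- The direct sum of the left ideals `R * e x`, inside a free module. -/
noncomputable def idempotentProjection {ι : Type u} (e : ι → R) : (ι →₀ R) →ₗ[R] (ι →₀ R) :=
  Finsupp.linearCombination R fun x => Finsupp.single x (e x)

theorem idempotentProjection_apply {ι : Type u} (e : ι → R) (f : ι →₀ R) (x : ι) :
    idempotentProjection e f x = f x * e x := by
  classical
  simp only [idempotentProjection, Finsupp.linearCombination_apply, Finsupp.sum,
    Finsupp.finsetSum_apply, Finsupp.smul_single, smul_eq_mul, Finsupp.single_apply]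
  simp +contextual

theorem idempotentProjection_idem {ι : Type u} {e : ι → R} (he : ∀ x, IsIdempotentElem (e x))
    (f : ι →₀ R) :
    idempotentProjection e (idempotentProjection e f) = idempotentProjection e f := by
  ext x
  rw [idempotentProjection_apply, idempotentProjection_apply, mul_assoc, he x]

/-- The inclusion into the free module is split by the idempotent itself. Keeping the sum of the `R
* e x` inside a free module gives its elements coordinates. -/
theorem projective_range_idempotentProjection {ι : Type u} {e : ι → R}
    (he : ∀ x, IsIdempotentElem (e x)) :
    Module.Projective R (LinearMap.range (idempotentProjection e)) := by
  refine Module.Projective.of_split (LinearMap.range (idempotentProjection e)).subtype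
    (idempotentProjection e).rangeRestrict (LinearMap.ext ?_)
  rintro ⟨_, f, rfl⟩
  exact Subtype.ext (idempotentProjection_idem he f)

variable {k : Type u} [Field k] [Algebra k R] {n : ℕ} {e : Fin n → R}

/-- Over a triangular ring with diagonal entries `k`, a module supported on the vertices `≥ r` is a
quotient of a projective module by a submodule supported on the vertices `> r`. -/
theorem exists_projective_cover_of_triangular (he : ∀ i, IsIdempotentElem (e i))
    (tri : ∀ i j, i < j → ∀ x, e i * x * e j = 0)
    (diag : ∀ i x, ∃ c : k, e i * x * e i = c • e i)
    (gen : (1 : R) ∈ TwoSidedIdeal.span (Set.range e)) (M : Type u) [AddCommGroup M] [Module R M]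
    (r : Fin n) (hM : ∀ i < r, ∀ m : M, e i • m = 0) :
    ∃ (P : Type u) (_ : AddCommGroup P) (_ : Module R P) (_ : Module.Projective R P)
      (f : P →ₗ[R] M), Function.Surjective f ∧
        ∀ i ≤ r, ∀ p : P, f p = 0 → e i • p = 0 := by
  let _ : Module k M := Module.compHom M (algebraMap k R)
  have : IsScalarTower k R M := IsScalarTower.of_algebraMap_smul fun _ _ => rfl
  let V : Submodule k M := LinearMap.range (Module.toModuleEnd k (S := R) M (e r))
  let b := Module.Basis.ofVectorSpace k V
  let B := Module.Basis.ofVectorSpaceIndex k V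
  -- One summand `R * e r` for each basis vector of `e r • M`, so that the kernel vanishes at `r`.
  -- At higher vertices no minimality is needed: one summand for every pair `(j, m)` with `r < j`.
  let ι : Type u := B ⊕ {p : Fin n × M // r < p.1}
  let idx : ι → Fin n := Sum.elim (fun _ => r) fun p => p.1.1
  let s : ι → M := Sum.elim (fun x => (b x : M)) fun p => e p.1.1 • p.1.2
  have hidx : ∀ x, r ≤ idx x := by
    rintro (x | ⟨p, hp⟩)
    · exact le_rfl
    · exact hp.le
  have hV : ∀ v : V, e r • (v : M) = v := by
    rintro ⟨_, m, rfl⟩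
    change e r • e r • m = e r • m
    rw [← mul_smul, he r]
  have hs : ∀ x, e (idx x) • s x = s x := by
    rintro (x | ⟨p, hp⟩)
    · exact hV _
    · change e p.1 • e p.1 • p.2 = e p.1 • p.2
      rw [← mul_smul, he]
  let E := idempotentProjection fun x => e (idx x)
  let f : LinearMap.range E →ₗ[R] M :=
    (Finsupp.linearCombination R s) ∘ₗ (LinearMap.range E).subtype
  refine ⟨LinearMap.range E, inferInstance, inferInstance,
    projective_range_idempotentProjection fun x => he _, f, ?_, ?_⟩
  · have hsN : ∀ x, s x ∈ LinearMap.range f := fun x =>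
      ⟨⟨E (Finsupp.single x 1), ⟨_, rfl⟩⟩, by
        change Finsupp.linearCombination R s (E (Finsupp.single x 1)) = s x
        simp [E, idempotentProjection, hs]⟩
    have hN : ∀ i (m : M), e i • m ∈ LinearMap.range f := by
      intro i m
      rcases lt_trichotomy i r with h | rfl | h
      · rw [hM i h]
        exact zero_mem _
      · have hb : (⊤ : Submodule k V) ≤
            ((LinearMap.range f).restrictScalars k).comap V.subtype := by
          rw [← b.span_eq, Submodule.span_le]
          rintro _ ⟨x, rfl⟩
          exact hsN (Sum.inl x)
        exact hb (x := ⟨e i • m, m, rfl⟩) trivial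
      · exact hsN (Sum.inr ⟨(i, m), h⟩)
    -- The image contains every `e i • m`, so all the `e i` annihilate the cokernel.
    have : Subsingleton (M ⧸ LinearMap.range f) := by
      refine subsingleton_of_smul_eq_zero gen fun i q => ?_
      obtain ⟨m, rfl⟩ := Submodule.Quotient.mk_surjective _ q
      rw [← Submodule.Quotient.mk_smul, Submodule.Quotient.mk_eq_zero]
      exact hN i m
    rw [← LinearMap.range_eq_top]
    exact Submodule.Quotient.subsingleton_iff.1 this
  · rintro i hi ⟨g, g', rfl⟩ hg
    replace hg : Finsupp.linearCombination R s (E g') = 0 := hg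
    refine Subtype.ext (Finsupp.ext fun x => ?_)
    change e i * E g' x = 0
    have hE : ∀ x, e i * E g' x = e i * g' x * e (idx x) := fun x => by
      rw [mul_assoc]
      exact congrArg (e i * ·) (idempotentProjection_apply _ _ _)
    -- For `i < r`, triangularity already gives `e i • P = 0`. For `i = r` only the coordinates in
    -- `B` survive, and they are scalars.
    rcases hi.lt_or_eq with h | rfl
    · rw [hE]
      exact tri _ _ (h.trans_le (hidx x)) _
    · rcases x with x | x
      swap
      · rw [hE]
        exact tri _ _ x.2 _
      choose c hc using fun x => diag i (g' x)
      have h0 : ∀ x ∉ (E g').support, e i * E g' x = 0 := fun x hx => by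
        rw [Finsupp.notMem_support_iff.1 hx, mul_zero]
      have hsum : ∑ x ∈ (E g').support, (e i * E g' x) • s x = 0 := by
        have := congrArg (e i • ·) hg
        simpa only [Finsupp.linearCombination_apply, Finsupp.sum, Finset.smul_sum, smul_smul,
          smul_zero] using this
      have hinl : ∀ x : B, (e i * E g' (Sum.inl x)) • s (Sum.inl x) = c (Sum.inl x) • (b x : M) := by
        intro x
        rw [hE]
        change (e i * g' (Sum.inl x) * e i) • (b x : M) = _
        rw [hc, smul_assoc, hV]
      let t : Finset B := (E g').support.preimage Sum.inl Sum.inl_injective.injOn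
      -- Acting by `e r` on the relation `f p = 0` leaves a linear relation over `k` between basis
      -- vectors, so its coefficients vanish.
      have ht : ∑ y ∈ t, c (Sum.inl y) • b y = 0 := by
        apply Subtype.ext
        rw [Submodule.coe_zero, ← hsum, AddSubmonoidClass.coe_finsetSum,
          ← Finset.sum_preimage (Sum.inl : B → ι) _ Sum.inl_injective.injOn]
        · exact Finset.sum_congr rfl fun y _ => (hinl y).symm
        · rintro (y | y) _ hy
          · exact absurd ⟨y, rfl⟩ hy
          · have := tri i (idx (Sum.inr y)) y.2 (g' (Sum.inr y))
            rw [hE, this, zero_smul]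
      by_cases hx : x ∈ t
      · have := linearIndependent_iff'.1 b.linearIndependent t _ ht x hx
        rw [hE]
        change e i * g' (Sum.inl x) * e i = 0
        rw [hc, this, zero_smul]
      · exact h0 _ fun h => hx (Finset.mem_preimage.2 h)

/-- Induction on `d`, which bounds the number of vertices, counted from the top, where `M` may be
nonzero. -/
theorem hasProjectiveDimensionLT_of_triangular (he : ∀ i, IsIdempotentElem (e i))
    (tri : ∀ i j, i < j → ∀ x, e i * x * e j = 0)
    (diag : ∀ i x, ∃ c : k, e i * x * e i = c • e i)
    (gen : (1 : R) ∈ TwoSidedIdeal.span (Set.range e)) (d : ℕ) (M : ModuleCat.{u} R)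
    (hM : ∀ i : Fin n, i.val + d < n → ∀ m : M, e i • m = 0) :
    HasProjectiveDimensionLT M d := by
  induction d generalizing M with
  | zero =>
    have := subsingleton_of_smul_eq_zero gen fun i => hM i i.2
    exact (ModuleCat.isZero_of_subsingleton M).hasProjectiveDimensionLT_zero
  | succ d ih =>
    by_cases hd : d < n
    -- The lowest vertex allowed for `M` is `n - (d + 1)`; the kernel also vanishes there, which is
    -- the hypothesis for `d`.
    · obtain ⟨P, _, _, _, f, hf, hK⟩ := exists_projective_cover_of_triangular he tri diag gen M
        ⟨n - (d + 1), by lia⟩ fun i hi => hM i (by have : i.val < n - (d + 1) := hi; lia)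
      have hfg : LinearMap.range (ModuleCat.ofHom (LinearMap.ker f).subtype).hom =
          LinearMap.ker (ModuleCat.ofHom f).hom := Submodule.range_subtype _
      have hS : (ShortComplex.moduleCatMkOfKerLERange
          (ModuleCat.ofHom (LinearMap.ker f).subtype) (ModuleCat.ofHom f) hfg.le).ShortExact :=
        { exact := ShortComplex.Exact.moduleCat_of_range_eq_ker _ _ hfg
          mono_f := (ModuleCat.mono_iff_injective _).2 (Submodule.subtype_injective _)
          epi_g := (ModuleCat.epi_iff_surjective _).2 hf }
      have hP : Projective (ModuleCat.of R P) := (IsProjective.iff_projective (R := R) P).1 ‹_›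
      have hP' : HasProjectiveDimensionLT (ModuleCat.of R P) (d + 1) :=
        hasProjectiveDimensionLT_of_ge _ 1 _ (by lia)
      refine hS.hasProjectiveDimensionLT_X₃ d (ih _ fun i hi m => ?_) hP'
      exact Subtype.ext (hK i (Fin.le_def.2 (by simp; lia)) m.1 m.2)
    · have := ih M fun i hi => absurd hi (by lia)
      exact hasProjectiveDimensionLT_of_ge M d _ (by lia)

end Ring

/-! ### Endomorphism rings and Ext groups of biproducts -/

section Biproduct

variable {C : Type*} [Category.{u} C] [Preadditive C] [HasFiniteBiproducts C]

theorem hasFiniteGlobalDimension_end_biproduct {k : Type u} [Field k] [Linear k C] {n : ℕ}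
    (F : Fin n → C) (diag : ∀ i (f : F i ⟶ F i), ∃ c : k, f = c • 𝟙 (F i))
    (tri : ∀ i j, i < j → ∀ f : F j ⟶ F i, f = 0) (l : Fin n → ℕ) (hl : ∀ i, 1 ≤ l i) :
    CohSheaf.HasFiniteGlobalDimension (End (⨁ fun i => ⨁ fun _ : Fin (l i) => F i)) := by
  let G : Fin n → C := fun i => ⨁ fun _ : Fin (l i) => F i
  let T : C := ⨁ G
  let a (i : Fin n) (x : Fin (l i)) : F i ⟶ T :=
    biproduct.ι (fun _ : Fin (l i) => F i) x ≫ biproduct.ι G i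
  let p (i : Fin n) (x : Fin (l i)) : T ⟶ F i :=
    biproduct.π G i ≫ biproduct.π (fun _ : Fin (l i) => F i) x
  have hap : ∀ i x, a i x ≫ p i x = 𝟙 _ := fun i x => by simp [a, p]
  have htot : 𝟙 T = ∑ i, ∑ x, p i x ≫ a i x := by
    have h : ∀ i, ∑ x, p i x ≫ a i x = biproduct.π G i ≫ biproduct.ι G i := fun i => by
      have := biproduct.total (f := fun _ : Fin (l i) => F i)
      calc _ = biproduct.π G i ≫ (∑ x, biproduct.π (fun _ : Fin (l i) => F i) x ≫
            biproduct.ι (fun _ : Fin (l i) => F i) x) ≫ biproduct.ι G i := by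
            simp [a, p, Preadditive.sum_comp, Preadditive.comp_sum]
        _ = _ := by rw [this, Category.id_comp]
    simp_rw [h]
    exact biproduct.total.symm
  let x₀ (i : Fin n) : Fin (l i) := ⟨0, hl i⟩
  let e : Fin n → End T := fun i => p i (x₀ i) ≫ a i (x₀ i)
  -- Dimension at most `n` means dimension `< n + 1`, and for `d = n + 1` the support condition is
  -- vacuous.
  refine ⟨n, fun M => ?_⟩
  have key := hasProjectiveDimensionLT_of_triangular (k := k) (e := e) (fun i => ?_)
    (fun i j hij f => ?_) (fun i f => ?_) ?_ (n + 1) M (fun i hi => absurd hi (by lia))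
  · exact key
  · change (p i (x₀ i) ≫ a i (x₀ i)) ≫ p i (x₀ i) ≫ a i (x₀ i) = p i (x₀ i) ≫ a i (x₀ i)
    rw [Category.assoc, reassoc_of% (hap i)]
  -- Multiplication in `End` reverses composition, so `e i * f * e j` factors through a morphism `F
  -- j ⟶ F i`.
  · change (p j (x₀ j) ≫ a j (x₀ j)) ≫ f ≫ p i (x₀ i) ≫ a i (x₀ i) = (0 : T ⟶ T)
    have := tri i j hij (a j (x₀ j) ≫ f ≫ p i (x₀ i))
    calc _ = p j (x₀ j) ≫ (a j (x₀ j) ≫ f ≫ p i (x₀ i)) ≫ a i (x₀ i) := by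
          simp only [Category.assoc]
      _ = 0 := by rw [this, zero_comp, comp_zero]
  · obtain ⟨c, hc⟩ := diag i (a i (x₀ i) ≫ f ≫ p i (x₀ i))
    refine ⟨c, ?_⟩
    change (p i (x₀ i) ≫ a i (x₀ i)) ≫ f ≫ p i (x₀ i) ≫ a i (x₀ i) =
      c • (p i (x₀ i) ≫ a i (x₀ i))
    calc _ = p i (x₀ i) ≫ (a i (x₀ i) ≫ f ≫ p i (x₀ i)) ≫ a i (x₀ i) := by
          simp only [Category.assoc]
      _ = _ := by rw [hc, Linear.smul_comp, Linear.comp_smul, Category.id_comp]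
  · change (𝟙 T : End T) ∈ _
    rw [htot]
    refine sum_mem fun i _ => sum_mem fun x _ => ?_
    -- The projection onto any copy of `F i` factors through the chosen copy, hence lies in the
    -- ideal generated by `e i`.
    have h : p i x ≫ a i x = (p i x ≫ a i (x₀ i)) ≫ (p i (x₀ i) ≫ a i (x₀ i)) ≫
        p i (x₀ i) ≫ a i x := by
      simp only [Category.assoc, reassoc_of% (hap i)]
    rw [h]
    change (show End T from p i (x₀ i) ≫ a i x) * e i * (show End T from p i x ≫ a i (x₀ i)) ∈ _
    exact TwoSidedIdeal.mul_mem_right _ _ _ (TwoSidedIdeal.mul_mem_left _ _ _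
      (TwoSidedIdeal.subset_span ⟨i, rfl⟩))

end Biproduct

theorem subsingleton_ext_biproduct {C : Type*} [Category* C] [Abelian C] [HasExt C]
    {I J : Type*} [Fintype I] [Fintype J] (X : I → C) (Y : J → C) (n : ℕ)
    (h : ∀ i j, Subsingleton (Abelian.Ext (X i) (Y j) n)) [HasBiproduct X] [HasBiproduct Y] :
    Subsingleton (Abelian.Ext (⨁ X) (⨁ Y) n) := by
  have (i : I) : Subsingleton (Abelian.Ext (X i) (⨁ Y) n) :=
    (Abelian.Ext.addEquivBiproduct (X i) (biproduct.isBilimit Y) n).toEquiv.subsingleton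
  exact (Abelian.Ext.biproductAddEquiv (biproduct.isBilimit X) (⨁ Y) n).toEquiv.subsingleton

/-! ### Comparing coherent sheaves with `D^b(X)` -/

namespace CohSheaf

variable {X : Scheme.{u}} [IsLocallyNoetherian X]

/-- Ext is Hom into a shift in the full derived category, of which `D^b(X)` is a full subcategory;
`commShiftIso` matches the two shifts. -/
theorem subsingleton_ext_of_hom_shift {F G : Coh X} (n : ℕ)
    (h : ∀ f : toDb F ⟶ (toDb G)⟦(n : ℤ)⟧, f = 0) : Subsingleton (Abelian.Ext F G n) := by
  refine (Abelian.Ext.homEquiv (X := F) (Y := G) (n := n)).subsingleton_congr.2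
    (subsingleton_of_forall_eq 0 fun g => ?_)
  let i := (DerivedCategory.Bounded.ι (C := Coh X)).commShiftIso (n : ℤ)
  let f : toDb F ⟶ (toDb G)⟦(n : ℤ)⟧ :=
    ObjectProperty.homMk (g ≫ i.inv.app (toDb G))
  have hf : g ≫ i.inv.app (toDb G) = 0 := congrArg (·.hom) (h f)
  have := congrArg (· ≫ i.hom.app (toDb G)) hf
  simpa using this

theorem hom_eq_zero_of_hom_shift {F G : Coh X}
    (h : ∀ f : toDb F ⟶ (toDb G)⟦(0 : ℤ)⟧, f = 0) (f : F ⟶ G) : f = 0 := by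
  have := subsingleton_ext_of_hom_shift 0 h
  exact (Abelian.Ext.homEquiv₀ (X := F) (Y := G)).symm.injective (Subsingleton.elim _ _)

/-- The functor placing a sheaf in degree `0` is faithful and `k`-linear, so the scalar found in
`D^b(X)` also works for sheaves. -/
theorem exists_eq_smul_id {k : Type u} [Field k] [X.Over (Spec (.of k))] {F : Coh X}
    (h : IsExceptional k (toDb F)) (f : F ⟶ F) : ∃ c : k, f = c • 𝟙 F := by
  obtain ⟨c, hc⟩ := h.hom_self.2
    (ObjectProperty.homMk ((DerivedCategory.singleFunctor (Coh X) 0).map f))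
  refine ⟨c, (DerivedCategory.singleFunctor (Coh X) 0).map_injective ?_⟩
  rw [Functor.map_smul, CategoryTheory.Functor.map_id]
  exact (congrArg (·.hom) hc).symm

/-- A retract of coherent sheaves, in the bounded derived category. -/
noncomputable def retractToDb {F G : Coh X} (r : Retract F G) : Retract (toDb F) (toDb G) where
  i := ObjectProperty.homMk ((DerivedCategory.singleFunctor (Coh X) 0).map r.i)
  r := ObjectProperty.homMk ((DerivedCategory.singleFunctor (Coh X) 0).map r.r)
  retract := ObjectProperty.hom_ext _ (by
    change (DerivedCategory.singleFunctor (Coh X) 0).map r.i ≫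
      (DerivedCategory.singleFunctor (Coh X) 0).map r.r = 𝟙 _
    rw [← Functor.map_comp, r.retract, CategoryTheory.Functor.map_id])

theorem Generates.of_retract {ι : Type*} {F : ι → Coh X} {T : Coh X}
    (hF : Generates fun i => toDb (F i)) (r : ∀ i, Retract (F i) T) :
    Generates fun _ : Unit => toDb T := by
  have : (ObjectProperty.ofObj fun _ : Unit => toDb T).Nonempty := ⟨_, ⟨()⟩⟩
  refine eq_top_iff.2 (le_of_eq_of_le (Eq.symm hF)
    ((ObjectProperty.triangEnvelope_le_iff _).2 ?_))
  rintro _ ⟨i⟩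
  exact ObjectProperty.prop_of_retract _ (retractToDb (r i))
    (ObjectProperty.le_triangEnvelope _ _ ⟨()⟩)

end CohSheaf

theorem lemmal {k : Type u} [Field k] (X : Scheme.{u}) [X.Over (Spec (.of k))] [IsNoetherian X]
    {n : ℕ} (F : Fin (n + 1) → CohSheaf.Coh X)
    (hF : CohSheaf.IsFullStrongExceptionalCollection k fun i => CohSheaf.toDb (F i))
    (l : Fin (n + 1) → ℕ) (hl : ∀ i, 1 ≤ l i) :
    CohSheaf.IsTilting (⨁ fun i => ⨁ fun _ : Fin (l i) => F i) where
  finite_globalDimension := hasFiniteGlobalDimension_end_biproduct (k := k) F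
    (fun i => CohSheaf.exists_eq_smul_id (hF.exceptional i))
    (fun i j hij => CohSheaf.hom_eq_zero_of_hom_shift (hF.hom_shift i j hij 0)) l hl
  ext_self m hm e := by
    have h (j i : Fin (n + 1)) : Subsingleton (Abelian.Ext (F j) (F i) m) := by
      refine CohSheaf.subsingleton_ext_of_hom_shift m fun f => ?_
      -- For `i < j` all shifts vanish; for `j ≤ i` strongness needs a nonzero shift, which is where
      -- `0 < m` enters.
      rcases lt_or_ge i j with hij | hij
      · exact hF.hom_shift i j hij m f
      · exact hF.strong i j hij m (by lia) f
    have := subsingleton_ext_biproduct (fun i => ⨁ fun _ : Fin (l i) => F i)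
      (fun i => ⨁ fun _ : Fin (l i) => F i) m fun j i =>
        subsingleton_ext_biproduct _ _ m fun _ _ => h j i
    exact Subsingleton.elim _ _
  generates := hF.full.of_retract fun i =>
    { i := biproduct.ι (fun _ : Fin (l i) => F i) ⟨0, hl i⟩ ≫
        biproduct.ι (fun i => ⨁ fun _ : Fin (l i) => F i) i
      r := biproduct.π (fun i => ⨁ fun _ : Fin (l i) => F i) i ≫
        biproduct.π (fun _ : Fin (l i) => F i) ⟨0, hl i⟩ }
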